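/- Let $X$ be a real Banach space with continuous dual $X^*$, and let $C\subseteq X$ be a closed convex set whose strong quasi relative interior $$\mathrm{sqri}(C)=\{x\in C:\ \mathrm{cone}(C-x)\ \text{is a closed linear subspace of } X\},\qquad \mathrm{cone}(U)=\bigcup_{\lambda\ge 0}\lambda U,$$ is nonempty. Let $F:C\times C\to\mathbb{R}$ satisfy $F(x,x)=0$ for all $x\in C$ and be monotone, i.e. $F(x,y)+F(y,x)\le 0$ for all $x,y\in C$. Assume that for every $x\in C$ the function $F(x,\cdot)$ is convex and lower semicontinuous on $C$, and that for every $y\in C$ the function $F(\cdot,y)$ is upper hemicontinuous on $C$, i.e. upper semicontinuous on every line segment contained in $C$. Then $F$ is a maximal monotone bifunction; that is, the operator $A^F:X\rightrightarrows X^*$ defined by $$A^F(x)=\{x^*\in X^*:\ F(x,y)-F(x,x)\ge\langle x^*,y-x\rangle\ \text{for all } y\in C\}\quad (x\in C),\qquad A^F(x)=\emptyset\quad (x\notin C),$$ is maximal monotone: $\langle y^*-x^*,y-x\rangle\ge 0$ whenever $x^*\in A^F(x)$ and $y^*\in A^F(y)$, and the graph $\{(x,x^*): x^*\in A^F(x)\}$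 is not properly contained in the graph of any other operator $X\rightrightarrows X^*$ with this property. -/

import Mathlib

namespace MaxMonBifunction

/-- The conical hull `⋃_{r ≥ 0} r U` of a set `U`. -/
def cone {X : Type*} [AddCommGroup X] [Module ℝ X] (U : Set X) : Set X :=
  {z | ∃ r : ℝ, 0 ≤ r ∧ ∃ u ∈ U, z = r • u}

/-- The strong quasi relative interior of a (convex) set `U`: the points `x ∈ U` such that
`cone (U - x)` is a closed linear subspace. -/
def sqri {X : Type*} [NormedAddCommGroup X] [NormedSpace ℝ X] (U : Set X) : Set X :=
  {x | x ∈ U ∧ ∃ S : Submodule ℝ X,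
    IsClosed (S : Set X) ∧ cone ((fun u : X => u - x) '' U) = (S : Set X)}

/-- `f` is upper hemicontinuous on `C`: its restriction to each line segment with endpoints in `C`
is upper semicontinuous. -/
def UpperHemicontOn {X : Type*} [NormedAddCommGroup X] [NormedSpace ℝ X]
    (f : X → ℝ) (C : Set X) : Prop :=
  ∀ a ∈ C, ∀ b ∈ C, UpperSemicontinuousOn f (segment ℝ a b)

/-- The graph of a multifunction `T : X ⇉ X*`. -/
def graph {X : Type*} [NormedAddCommGroup X] [NormedSpace ℝ X]
    (T : X → Set (StrongDual ℝ X)) : Set (X × StrongDual ℝ X) :=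
  {p | p.2 ∈ T p.1}

/-- Monotone operators `T : X ⇉ X*`. -/
def IsMonotoneOp {X : Type*} [NormedAddCommGroup X] [NormedSpace ℝ X]
    (T : X → Set (StrongDual ℝ X)) : Prop :=
  ∀ x y : X, ∀ x' ∈ T x, ∀ y' ∈ T y, 0 ≤ (y' - x') (y - x)

/-- Maximal monotone operators: monotone, and the graph is not properly included in the graph of
any monotone operator. -/
def IsMaximalMonotoneOp {X : Type*} [NormedAddCommGroup X] [NormedSpace ℝ X]
    (T : X → Set (StrongDual ℝ X)) : Prop :=
  IsMonotoneOp T ∧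
    ∀ S : X → Set (StrongDual ℝ X), IsMonotoneOp S → ¬ graph T ⊂ graph S

/-- Monotone bifunctions on `C`. A bifunction `C × C → ℝ` is given by a function `X → X → ℝ` of
which only the values on `C × C` are ever used. -/
def IsMonotoneBifun {X : Type*} (C : Set X) (F : X → X → ℝ) : Prop :=
  ∀ x ∈ C, ∀ y ∈ C, F x y + F y x ≤ 0

/-- The operator `A^F : X ⇉ X*` of a bifunction `F` on `C`; it is empty-valued off `C`. -/
def opA {X : Type*} [NormedAddCommGroup X] [NormedSpace ℝ X]
    (C : Set X) (F : X → X → ℝ) (x : X) : Set (StrongDual ℝ X) :=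
  {x' | x ∈ C ∧ ∀ y ∈ C, x' (y - x) ≤ F x y - F x x}

/-- Maximal monotone bifunctions: monotone bifunctions `F` with `A^F` maximal monotone. -/
def IsMaximalMonotoneBifun {X : Type*} [NormedAddCommGroup X] [NormedSpace ℝ X]
    (C : Set X) (F : X → X → ℝ) : Prop :=
  IsMonotoneBifun C F ∧ IsMaximalMonotoneOp (opA C F)

end MaxMonBifunction

/-! Tilting `F` by a functional reduces maximality to this: if `(x₀, 0)` is monotonically related to
the operator of `G`, then `x₀ ∈ C` and `G x₀ ≥ 0` on `C`. When `C` is solid, Baire and Hahn–Banach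
(`exists_dual_between`) turn a ray below the graph of `G y` into a subgradient `ν` at `y`. A ray
rising towards `x₀` gives `ν (x₀ - y) > 0`, contradicting the relation. This yields `G y z ≥ 0` for
interior `y` between `z` and `x₀`, and hemicontinuity carries it to boundary points. If `x₀ ∉ C`,
the same contradiction arises at the last point of `C` on a segment towards `x₀`. For general `C`, a
point `p` of `sqri C` makes `C - p` solid in the closed subspace it spans. -/

namespace MaxMonBifunction

open Set Filter Topology

section Solid

variable {Y : Type*} [NormedAddCommGroup Y] [NormedSpace ℝ Y]

/-- A closed convex set of a Banach space which absorbs every direction from one of its points has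
nonempty interior. -/
theorem interior_nonempty_of_absorbing [CompleteSpace Y] {A : Set Y} (hA : Convex ℝ A)
    (hcl : IsClosed A) {p : Y} (hp : p ∈ A) (habs : ∀ v : Y, ∃ t : ℝ, 0 < t ∧ p + t • v ∈ A) :
    (interior A).Nonempty := by
  -- Baire: the closed preimages of `A` under these dilations cover `Y`; `ψ` below inverts `φ n`.
  let φ : ℕ → Y → Y := fun n v => p + (1 / ((n : ℝ) + 1)) • v
  have hφ : ∀ n, Continuous (φ n) := fun n => by fun_prop
  have hcov : ⋃ n, φ n ⁻¹' A = univ := by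
    refine eq_univ_of_forall fun v => ?_
    obtain ⟨t, ht, hv⟩ := habs v
    obtain ⟨n, hn⟩ := exists_nat_one_div_lt ht
    refine mem_iUnion.2 ⟨n, ?_⟩
    have hpos : (0 : ℝ) < 1 / ((n : ℝ) + 1) := by positivity
    have := hA.add_smul_mem hp hv (t := 1 / ((n : ℝ) + 1) / t)
      ⟨by positivity, (div_le_one ht).2 hn.le⟩
    rwa [smul_smul, div_mul_cancel₀ _ ht.ne'] at this
  obtain ⟨n, v, hv⟩ := nonempty_interior_of_iUnion_of_closed (fun n => hcl.preimage (hφ n)) hcov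
  have hn : (0 : ℝ) < 1 / ((n : ℝ) + 1) := by positivity
  let ψ : Y → Y := fun y => (1 / ((n : ℝ) + 1))⁻¹ • (y - p)
  have hψ : Continuous ψ := by fun_prop
  refine ⟨φ n v, mem_interior.2 ⟨ψ ⁻¹' interior (φ n ⁻¹' A), ?_, isOpen_interior.preimage hψ, ?_⟩⟩
  · intro y hy
    have h1 : ψ y ∈ φ n ⁻¹' A := interior_subset hy
    have h2 : φ n (ψ y) = y := by
      simp only [φ, ψ]
      rw [smul_inv_smul₀ hn.ne', add_sub_cancel]
    rwa [mem_preimage, h2] at h1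
  · have h2 : ψ (φ n v) = v := by
      simp only [φ, ψ]
      rw [add_sub_cancel_left, inv_smul_smul₀ hn.ne']
    rwa [mem_preimage, h2]

/-- From an interior point one can move a little in each direction. -/
theorem exists_pos_add_smul_mem {C : Set Y} {p : Y} (hp : p ∈ interior C) (v : Y) :
    ∃ t : ℝ, 0 < t ∧ p + t • v ∈ C := by
  have hc : Tendsto (fun t : ℝ => p + t • v) (𝓝 0) (𝓝 p) := by
    have : Continuous fun t : ℝ => p + t • v := by fun_prop
    simpa using this.tendsto 0
  have h : ∀ᶠ t : ℝ in 𝓝[>] 0, p + t • v ∈ C :=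
    (hc.mono_left nhdsWithin_le_nhds) (mem_interior_iff_mem_nhds.1 hp)
  obtain ⟨t, ht, ht0⟩ := (h.and self_mem_nhdsWithin).exists
  exact ⟨t, ht0, ht⟩

/-- A lower semicontinuous convex function on a closed convex set with nonempty interior in a Banach
space has an epigraph with nonempty interior. -/
theorem interior_epigraph_nonempty [CompleteSpace Y] {C : Set Y} (hcl : IsClosed C)
    (hint : (interior C).Nonempty) {f : Y → ℝ} (hf : ConvexOn ℝ C f)
    (hlsc : LowerSemicontinuousOn f C) :
    (interior {q : Y × ℝ | q.1 ∈ C ∧ f q.1 ≤ q.2}).Nonempty := by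
  obtain ⟨p, hp⟩ := hint
  have hpC := interior_subset hp
  have hA : (interior {c ∈ C | f c ≤ f p + 1}).Nonempty := by
    refine interior_nonempty_of_absorbing (hf.convex_le _) ?_ (p := p) ⟨hpC, by simp⟩ ?_
    · obtain ⟨v, hv, he⟩ := lowerSemicontinuousOn_iff_preimage_Iic.1 hlsc (f p + 1)
      have : {c ∈ C | f c ≤ f p + 1} = C ∩ v := he
      rw [this]
      exact hcl.inter hv
    · intro v
      obtain ⟨t, ht, hv⟩ := exists_pos_add_smul_mem hp v
      -- Small enough that convexity raises `f` by at most 1 at `p + (θ * t) • v`.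
      let θ : ℝ := 1 / (1 + |f (p + t • v) - f p|)
      have hden : 0 < 1 + |f (p + t • v) - f p| := by positivity
      have hθ : 0 < θ := by positivity
      have hθ1 : θ ≤ 1 := (div_le_one hden).2 (by linarith [abs_nonneg (f (p + t • v) - f p)])
      have hθ2 : θ * (f (p + t • v) - f p) ≤ 1 := by
        rw [one_div_mul_eq_div, div_le_one hden]
        linarith [le_abs_self (f (p + t • v) - f p)]
      have hcomb : (1 - θ) • p + θ • (p + t • v) = p + (θ * t) • v := by module
      refine ⟨θ * t, by positivity, ?_, ?_⟩
      · rw [← hcomb]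
        exact hf.1 hpC hv (by linarith) hθ.le (by ring)
      · have := hf.2 hpC hv (by linarith : 0 ≤ 1 - θ) hθ.le (by ring)
        rw [hcomb] at this
        simp only [smul_eq_mul] at this
        linarith
  obtain ⟨u, hu⟩ := hA
  refine ⟨(u, f p + 2), mem_interior.2
    ⟨interior {c ∈ C | f c ≤ f p + 1} ×ˢ Ioi (f p + 1), ?_, isOpen_interior.prod isOpen_Ioi,
      hu, by simp⟩⟩
  rintro ⟨c, r⟩ ⟨hc, hr⟩
  have hc' := interior_subset hc
  exact ⟨hc'.1, hc'.2.trans (le_of_lt hr)⟩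

/-- Sandwich form of the Hahn–Banach theorem: if the convex set `K` of `Y × ℝ` lies below the graph
of the convex function `f` over `C`, passes through `(y, f y) = (y, 0)` and through a point over the
interior of `C`, then some affine function vanishing at `y` lies between `K` and `f`. -/
theorem exists_dual_between {C : Set Y} {f : Y → ℝ} (hf : ConvexOn ℝ C f)
    (hepi : (interior {q : Y × ℝ | q.1 ∈ C ∧ f q.1 ≤ q.2}).Nonempty)
    {K : Set (Y × ℝ)} (hK : Convex ℝ K) (hKf : ∀ q ∈ K, q.1 ∈ C → q.2 ≤ f q.1)
    {y : Y} (hy : y ∈ C) (hfy : f y = 0) (hyK : (y, (0 : ℝ)) ∈ K)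
    (hKint : ∃ q ∈ K, q.1 ∈ interior C) :
    ∃ ν : StrongDual ℝ Y, (∀ c ∈ C, ν (c - y) ≤ f c) ∧ ∀ q ∈ K, q.2 ≤ ν (q.1 - y) := by
  set E : Set (Y × ℝ) := {q | q.1 ∈ C ∧ f q.1 ≤ q.2}
  have hEc : Convex ℝ E := hf.convex_epigraph
  have hdisj : Disjoint (interior E) K := by
    refine Set.disjoint_left.2 fun q hqE hqK => ?_
    obtain ⟨t, ht, hmem⟩ := exists_pos_add_smul_mem hqE ((0 : Y), (-1 : ℝ))
    have hqC : q.1 ∈ C := (interior_subset hqE).1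
    have h1 := hKf q hqK hqC
    have h2 := hmem.2
    simp only [Prod.fst_add, Prod.snd_add, Prod.smul_fst, Prod.smul_snd, smul_zero, add_zero,
      smul_eq_mul] at h2
    linarith
  obtain ⟨g, u, hgE, hgK⟩ := geometric_hahn_banach_open hEc.interior isOpen_interior hK hdisj
  have hgE' : ∀ q ∈ E, g q ≤ u := by
    intro q hq
    have h1 : q ∈ closure (interior E) := by
      rw [hEc.closure_interior_eq_closure_of_nonempty_interior hepi]
      exact subset_closure hq
    exact closure_minimal (fun a ha => (hgE a ha).le)
      (isClosed_le g.continuous continuous_const) h1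
  let ν : StrongDual ℝ Y := g.comp (ContinuousLinearMap.inl ℝ Y ℝ)
  let α : ℝ := g (0, 1)
  have hg : ∀ (c : Y) (r : ℝ), g (c, r) = ν c + r * α := by
    intro c r
    have : (c, r) = (c, (0 : ℝ)) + r • ((0 : Y), (1 : ℝ)) := by simp
    rw [this, map_add, map_smul]
    simp [ν, α]
  have hαle : α ≤ 0 := by
    by_contra! hα
    obtain ⟨n, hn⟩ := exists_nat_gt ((u - ν y) / α)
    have h1 := hgE' (y, (n : ℝ)) ⟨hy, by simp [hfy]⟩
    rw [hg] at h1
    rw [div_lt_iff₀ hα] at hn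
    linarith
  -- A vertical hyperplane is impossible: `ν` would increase from `p` to `c`, and moving slightly
  -- past the interior point `c` would exceed `u` inside `C`.
  have hαne : α ≠ 0 := by
    intro hα
    obtain ⟨⟨c, r⟩, hqK, hcint⟩ := hKint
    obtain ⟨⟨p, s⟩, hpE⟩ := hepi
    have h1 := hgE _ hpE
    have h2 := hgK _ hqK
    obtain ⟨t, ht, hmem⟩ := exists_pos_add_smul_mem hcint (c - p)
    have h3 := hgE' (c + t • (c - p), f (c + t • (c - p))) ⟨hmem, le_rfl⟩
    rw [hg, hα] at h1 h2 h3
    simp only [map_add, map_smul, map_sub, smul_eq_mul] at h3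
    nlinarith
  have hα : 0 < -α := by
    have := lt_of_le_of_ne hαle hαne
    linarith
  have hyu : ν y ≤ u := by
    have := hgE' (y, 0) ⟨hy, hfy.le⟩
    rw [hg] at this
    linarith
  have huy : u ≤ ν y := by
    have := hgK _ hyK
    rw [hg] at this
    linarith
  refine ⟨(-α)⁻¹ • ν, fun c hc => ?_, ?_⟩
  · have := hgE' (c, f c) ⟨hc, le_rfl⟩
    rw [hg] at this
    rw [smul_apply, smul_eq_mul, map_sub]
    rw [inv_mul_le_iff₀ hα]
    linarith
  · rintro ⟨b, r⟩ hb
    have := hgK _ hb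
    rw [hg] at this
    rw [smul_apply, smul_eq_mul, map_sub]
    rw [le_inv_mul_iff₀ hα]
    linarith

/-- Rays in `Y × ℝ` are convex. -/
theorem convex_ray (a d : Y) (m τ : ℝ) :
    Convex ℝ ((fun t : ℝ => ((a + t • d, m * (t - τ)) : Y × ℝ)) '' Ici 0) := by
  rintro _ ⟨s, hs, rfl⟩ _ ⟨t, ht, rfl⟩ x y hx hy hxy
  refine ⟨x * s + y * t, add_nonneg (mul_nonneg hx hs) (mul_nonneg hy ht), ?_⟩
  obtain rfl : y = 1 - x := by linarith
  simp only [Prod.smul_mk, Prod.mk_add_mk, smul_eq_mul, Prod.mk.injEq]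
  exact ⟨by module, by ring⟩

variable [CompleteSpace Y] {C : Set Y} {G : Y → Y → ℝ} {x₀ : Y}

/-- Let `(x₀, 0)` be monotonically related to the operator of `G`. If an interior point `y` of `C`
lies between `z ∈ C` and `x₀`, then `G y z ≥ 0`. -/
theorem nonneg_of_interior_between (hcl : IsClosed C) (hdiag : ∀ x ∈ C, G x x = 0)
    (hconv : ∀ x ∈ C, ConvexOn ℝ C (G x)) (hlsc : ∀ x ∈ C, LowerSemicontinuousOn (G x) C)
    (hrel : ∀ y ∈ C, ∀ ν : StrongDual ℝ Y, (∀ c ∈ C, ν (c - y) ≤ G y c) → 0 ≤ ν (y - x₀))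
    {y z : Y} (hy : y ∈ interior C) (hz : z ∈ C) {s : ℝ} (hs : 0 < s)
    (hzy : z = y - s • (x₀ - y)) : 0 ≤ G y z := by
  by_contra! hneg
  have hyC := interior_subset hy
  have hm : 0 < -G y z / s := div_pos (by linarith) hs
  obtain ⟨ν, h1, h2⟩ := exists_dual_between (hconv y hyC)
    (interior_epigraph_nonempty hcl ⟨y, hy⟩ (hconv y hyC) (hlsc y hyC))
    (convex_ray y (x₀ - y) (-G y z / s) 0) (y := y) (by
      rintro _ ⟨t, ht, rfl⟩ hC
      have ht : 0 ≤ t := ht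
      have hst : 0 < s + t := by linarith
      -- `y` lies between `z` and the ray point, so `G y y = 0` forces `G y` to grow along the ray
      -- with slope at least `-G y z / s`.
      have h := (hconv y hyC).2 hz hC (by positivity : 0 ≤ t / (s + t))
        (by positivity : 0 ≤ s / (s + t)) (by field_simp; ring)
      have he : (t / (s + t)) • z + (s / (s + t)) • (y + t • (x₀ - y)) = y := by
        rw [hzy]
        match_scalars <;> field_simp <;> ring
      simp only at he h ⊢
      rw [he, hdiag y hyC] at h
      simp only [smul_eq_mul] at h
      have h' : 0 ≤ t * G y z + s * G y (y + t • (x₀ - y)) := by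
        have := mul_nonneg hst.le h
        calc _ ≤ _ := this
          _ = _ := by field_simp
      rw [sub_zero, div_mul_eq_mul_div, div_le_iff₀ hs]
      linarith) hyC (hdiag y hyC) ⟨0, by simp, by simp⟩
    ⟨_, ⟨0, by simp, rfl⟩, by simpa using hy⟩
  have h3 := h2 _ ⟨1, by simp, rfl⟩
  have h4 := hrel y hyC ν h1
  simp only [one_smul, add_sub_cancel, sub_zero, mul_one] at h3
  rw [← neg_sub x₀ y, map_neg] at h4
  linarith

/-- The same for a point `w ∈ C` between an interior point `z` and `x₀`, by hemicontinuity. -/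
theorem nonneg_of_between (hC : Convex ℝ C) (hcl : IsClosed C) (hdiag : ∀ x ∈ C, G x x = 0)
    (hconv : ∀ x ∈ C, ConvexOn ℝ C (G x)) (hlsc : ∀ x ∈ C, LowerSemicontinuousOn (G x) C)
    (husc : ∀ y ∈ C, UpperHemicontOn (fun x => G x y) C)
    (hrel : ∀ y ∈ C, ∀ ν : StrongDual ℝ Y, (∀ c ∈ C, ν (c - y) ≤ G y c) → 0 ≤ ν (y - x₀))
    {w z : Y} (hz : z ∈ interior C) (hw : w ∈ C) {τ : ℝ} (hτ : 0 ≤ τ) (hτ1 : τ ≤ 1)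
    (hwz : w = z + τ • (x₀ - z)) : 0 ≤ G w z := by
  have hzC := interior_subset hz
  rcases hτ.eq_or_lt with rfl | hτ
  · rw [zero_smul, add_zero] at hwz
    rw [hwz, hdiag z hzC]
  by_contra! hneg
  -- A negative value at `w` would persist at nearby points of the segment, which are interior and
  -- lie between `z` and `x₀`.
  have hev := husc z hzC z hzC w hw w (right_mem_segment ℝ z w) 0 hneg
  have hpar : ∀ t ∈ Ioo 0 τ, z + t • (x₀ - z) ∈ openSegment ℝ z w := by
    rintro t ⟨ht0, ht⟩
    refine ⟨1 - t / τ, t / τ, sub_pos.2 ((div_lt_one hτ).2 ht), by positivity, by ring, ?_⟩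
    rw [hwz]
    match_scalars <;> field_simp <;> ring
  have hIoo : ∀ᶠ t in 𝓝[<] τ, t ∈ Ioo 0 τ := Ioo_mem_nhdsLT hτ
  have htend : Tendsto (fun t : ℝ => z + t • (x₀ - z)) (𝓝[<] τ) (𝓝[segment ℝ z w] w) := by
    refine tendsto_nhdsWithin_iff.2 ⟨?_, hIoo.mono fun t ht =>
      openSegment_subset_segment ℝ z w (hpar t ht)⟩
    have : Continuous fun t : ℝ => z + t • (x₀ - z) := by fun_prop
    rw [hwz]
    exact (this.tendsto τ).mono_left nhdsWithin_le_nhds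
  obtain ⟨t, ht, htI⟩ := ((htend.eventually hev).and hIoo).exists
  have ht1 : 0 < 1 - t := by linarith [htI.2]
  have := nonneg_of_interior_between hcl hdiag hconv hlsc hrel
    (hC.openSegment_interior_self_subset_interior hz hw (hpar t htI)) hzC
    (s := t / (1 - t)) (div_pos htI.1 ht1) (by match_scalars <;> field_simp <;> ring)
  exact absurd this (not_le.2 ht)

/-- If `C` has nonempty interior, a point `(x₀, 0)` monotonically related to the operator of `G`
belongs to it. -/
theorem mem_of_related_of_interior_nonempty (hC : Convex ℝ C) (hcl : IsClosed C)
    (hint : (interior C).Nonempty) (hdiag : ∀ x ∈ C, G x x = 0)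
    (hconv : ∀ x ∈ C, ConvexOn ℝ C (G x)) (hlsc : ∀ x ∈ C, LowerSemicontinuousOn (G x) C)
    (husc : ∀ y ∈ C, UpperHemicontOn (fun x => G x y) C)
    (hrel : ∀ y ∈ C, ∀ ν : StrongDual ℝ Y, (∀ c ∈ C, ν (c - y) ≤ G y c) → 0 ≤ ν (y - x₀)) :
    x₀ ∈ C ∧ ∀ z ∈ C, 0 ≤ G x₀ z := by
  obtain ⟨z₀, hz₀⟩ := hint
  have hz₀C := interior_subset hz₀
  have hmem : x₀ ∈ C := by
    by_contra hx₀
    have hcont : Continuous fun t : ℝ => z₀ + t • (x₀ - z₀) := by fun_prop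
    -- `w`, at parameter `τ`, is the last point of `C` on the way to `x₀`.
    obtain ⟨τ, ⟨hτI, hw⟩, hmax⟩ := (isCompact_Icc.inter_right (hcl.preimage hcont)).exists_isGreatest
      (s := Icc (0 : ℝ) 1 ∩ (fun t : ℝ => z₀ + t • (x₀ - z₀)) ⁻¹' C) ⟨0, by simp, by simpa⟩
    have hτ1 : τ < 1 := by
      refine lt_of_le_of_ne hτI.2 ?_
      rintro rfl
      exact hx₀ (by simpa using hw)
    set w := z₀ + τ • (x₀ - z₀) with hwdef
    have hwC : w ∈ C := hw
    have hle : ∀ t : ℝ, 0 ≤ t → z₀ + t • (x₀ - z₀) ∈ C → t ≤ τ := by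
      intro t ht htC
      rcases le_or_gt t 1 with h1 | h1
      · exact hmax ⟨⟨ht, h1⟩, htC⟩
      · refine absurd ?_ hx₀
        have := hC.add_smul_mem hz₀C htC (t := 1 / t) ⟨by positivity, (div_le_one (by linarith)).2 h1.le⟩
        rwa [smul_smul, one_div_mul_cancel (by linarith), one_smul, add_sub_cancel] at this
    obtain ⟨ν, h1, h2⟩ := exists_dual_between (hconv w hwC)
      (interior_epigraph_nonempty hcl ⟨z₀, hz₀⟩ (hconv w hwC) (hlsc w hwC))
      -- The ray is nonpositive up to `w`, where `G w ≥ 0`, and beyond `w` it has left `C`. At `x₀`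
      -- its height is `1 - τ > 0`.
      (convex_ray z₀ (x₀ - z₀) 1 τ) (y := w) (by
        rintro _ ⟨t, ht, rfl⟩ htC
        have ht : 0 ≤ t := ht
        have htτ := hle t ht htC
        simp only at htC ⊢
        rcases htτ.eq_or_lt with rfl | hlt
        · rw [← hwdef, hdiag w hwC]
          simp
        have hzint : z₀ + t • (x₀ - z₀) ∈ interior C := by
          rcases ht.eq_or_lt with rfl | ht
          · simpa using hz₀
          · have hτ : 0 < τ := ht.trans hlt
            refine hC.openSegment_interior_self_subset_interior hz₀ hwC
              ⟨1 - t / τ, t / τ, sub_pos.2 ((div_lt_one hτ).2 hlt), by positivity, by ring, ?_⟩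
            rw [hwdef]
            match_scalars <;> field_simp <;> ring
        have ht1 : 0 < 1 - t := by linarith
        have := nonneg_of_between hC hcl hdiag hconv hlsc husc hrel hzint hwC
          (τ := (τ - t) / (1 - t)) (div_nonneg (by linarith) ht1.le)
          ((div_le_one ht1).2 (by linarith)) (by
            rw [hwdef]
            match_scalars <;> field_simp <;> ring)
        linarith) hwC (hdiag w hwC) ⟨τ, hτI.1, by simp [hwdef]⟩
      ⟨_, ⟨0, by simp, rfl⟩, by simpa using hz₀⟩
    have h3 := h2 _ ⟨1, by simp, rfl⟩
    have h4 := hrel w hwC ν h1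
    simp only [one_smul, add_sub_cancel, one_mul] at h3
    rw [← neg_sub x₀ w, map_neg] at h4
    linarith
  refine ⟨hmem, fun z hz => ?_⟩
  -- Interior points are settled; other `z` are approached along the segment to `z₀`.
  have hkey : ∀ t ∈ Ioo (0 : ℝ) 1, 0 ≤ (1 - t) * G x₀ z + t * G x₀ z₀ := by
    rintro t ⟨ht0, ht1⟩
    have h1 : (1 - t) • z + t • z₀ ∈ interior C :=
      hC.openSegment_self_interior_subset_interior hz hz₀ ⟨1 - t, t, by linarith, ht0, by ring, rfl⟩
    have h2 := nonneg_of_between hC hcl hdiag hconv hlsc husc hrel h1 hmem zero_le_one le_rfl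
      (by simp)
    exact h2.trans ((hconv x₀ hmem).2 hz hz₀C (by linarith) ht0.le (by ring))
  have htend : Tendsto (fun t : ℝ => (1 - t) * G x₀ z + t * G x₀ z₀) (𝓝[>] 0) (𝓝 (G x₀ z)) := by
    have : Continuous fun t : ℝ => (1 - t) * G x₀ z + t * G x₀ z₀ := by fun_prop
    simpa using (this.tendsto 0).mono_left (nhdsWithin_le_nhds (s := Ioi 0))
  have hIoo : ∀ᶠ t in 𝓝[>] (0 : ℝ), t ∈ Ioo (0 : ℝ) 1 := Ioo_mem_nhdsGT one_pos
  exact ge_of_tendsto htend (hIoo.mono hkey)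

end Solid

/-! ### Reduction to the closed subspace spanned by `C - p`. -/

variable {X : Type*} [NormedAddCommGroup X] [NormedSpace ℝ X] [CompleteSpace X]

/-- If the strong quasi relative interior of `C` is nonempty, a point `(x₀, 0)` monotonically
related to the operator of `G` belongs to it. -/
theorem mem_of_related {C : Set X} (hC : Convex ℝ C) (hcl : IsClosed C)
    (hsqri : (sqri C).Nonempty) {G : X → X → ℝ} {x₀ : X} (hdiag : ∀ x ∈ C, G x x = 0)
    (hconv : ∀ x ∈ C, ConvexOn ℝ C (G x)) (hlsc : ∀ x ∈ C, LowerSemicontinuousOn (G x) C)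
    (husc : ∀ y ∈ C, UpperHemicontOn (fun x => G x y) C)
    (hrel : ∀ y ∈ C, ∀ ν : StrongDual ℝ X, (∀ c ∈ C, ν (c - y) ≤ G y c) → 0 ≤ ν (y - x₀)) :
    x₀ ∈ C ∧ ∀ z ∈ C, 0 ≤ G x₀ z := by
  obtain ⟨p, hp, S, hS, hcone⟩ := hsqri
  have : CompleteSpace S := hS.completeSpace_coe
  have hsub : ∀ c ∈ C, c - p ∈ S := fun c hc => by
    rw [← SetLike.mem_coe, ← hcone]
    exact ⟨1, zero_le_one, c - p, ⟨c, hc, rfl⟩, (one_smul _ _).symm⟩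
  let φ : S → X := fun s => p + s
  have hφ : Continuous φ := by fun_prop
  have hφcomb : ∀ (a b : ℝ) (s t : S), a + b = 1 → φ (a • s + b • t) = a • φ s + b • φ t := by
    intro a b s t hab
    obtain rfl : b = 1 - a := by linarith
    simp only [φ, Submodule.coe_add, Submodule.coe_smul]
    module
  let D : Set S := φ ⁻¹' C
  have hlift : ∀ c ∈ C, ∃ s ∈ D, φ s = c := fun c hc => by
    have : φ ⟨c - p, hsub c hc⟩ = c := add_sub_cancel p c
    exact ⟨_, by rwa [mem_preimage, this], this⟩
  have hDconv : Convex ℝ D := by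
    intro s hs t ht a b ha hb hab
    rw [mem_preimage, hφcomb a b s t hab]
    exact hC hs ht ha hb hab
  have hDcl : IsClosed D := hcl.preimage hφ
  have h0D : (0 : S) ∈ D := by simpa [D, φ] using hp
  have hDint : (interior D).Nonempty := by
    refine interior_nonempty_of_absorbing hDconv hDcl h0D fun v => ?_
    have hv : (v : X) ∈ cone ((fun u : X => u - p) '' C) := hcone ▸ v.2
    obtain ⟨r, hr, _, ⟨c, hc, rfl⟩, hvr⟩ := hv
    rcases hr.eq_or_lt with rfl | hr
    · have : v = 0 := by
        ext
        simpa using hvr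
      exact ⟨1, one_pos, by simpa [this] using h0D⟩
    · refine ⟨r⁻¹, inv_pos.2 hr, ?_⟩
      have : φ (0 + r⁻¹ • v) = c := by
        simp only [φ, zero_add, Submodule.coe_smul, hvr]
        rw [inv_smul_smul₀ hr.ne', add_sub_cancel]
      rwa [mem_preimage, this]
  let H : S → S → ℝ := fun s t => G (φ s) (φ t)
  have hHdiag : ∀ s ∈ D, H s s = 0 := fun s hs => hdiag _ hs
  have hHconv : ∀ s ∈ D, ConvexOn ℝ D (H s) := fun s hs => by
    refine ⟨hDconv, fun t ht u hu a b ha hb hab => ?_⟩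
    simp only [H, hφcomb a b t u hab]
    exact (hconv _ hs).2 ht hu ha hb hab
  have hHlsc : ∀ s ∈ D, LowerSemicontinuousOn (H s) D := fun s hs =>
    (hlsc _ hs).comp hφ.continuousOn fun _ ht => ht
  have hHusc : ∀ t ∈ D, UpperHemicontOn (fun s => H s t) D := fun t ht a ha b hb => by
    refine (husc _ ht _ ha _ hb).comp hφ.continuousOn ?_
    rintro _ ⟨α, β, hα, hβ, hαβ, rfl⟩
    exact ⟨α, β, hα, hβ, hαβ, (hφcomb α β a b hαβ).symm⟩
  have hdiff : ∀ s t : S, φ s - φ t = ((s - t : S) : X) := fun s t => by simp [φ]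
  have hext : ∀ s ∈ D, ∀ ν : StrongDual ℝ X, (∀ t ∈ D, ν ((t - s : S) : X) ≤ H s t) →
      0 ≤ ν (φ s - x₀) := by
    intro s hs ν hν
    refine hrel _ hs ν fun c hc => ?_
    obtain ⟨t, ht, rfl⟩ := hlift c hc
    rw [hdiff]
    exact hν t ht
  have hx₀S : x₀ - p ∈ S := by
    obtain ⟨s, hs⟩ := hDint
    have hsD := interior_subset hs
    obtain ⟨ν, h1, -⟩ := exists_dual_between (hHconv s hsD)
      (interior_epigraph_nonempty hDcl ⟨s, hs⟩ (hHconv s hsD) (hHlsc s hsD))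
      (convex_singleton (s, (0 : ℝ))) (y := s) (by
        rintro _ rfl -
        exact (hHdiag s hsD).ge) hsD (hHdiag s hsD) rfl ⟨_, rfl, hs⟩
    obtain ⟨ν', hν', -⟩ := exists_extension_norm_eq S ν
    by_contra hnot
    have hnot' : φ s - x₀ ∉ S := fun h => hnot <| by
      have h' : (s : X) - (p + s - x₀) ∈ S := S.sub_mem s.2 h
      rwa [show (s : X) - (p + s - x₀) = x₀ - p by abel] at h'
    obtain ⟨g, u, hgS, hgu⟩ := geometric_hahn_banach_closed_point S.convex hS hnot'
    have hg0 : ∀ v ∈ S, g v = 0 := by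
      intro v hv
      by_contra hne
      have := hgS ((u / g v) • v) (S.smul_mem _ hv)
      rw [map_smul, smul_eq_mul, div_mul_cancel₀ _ hne] at this
      exact lt_irrefl _ this
    have hgpos : 0 < g (φ s - x₀) := by
      have := hgS 0 S.zero_mem
      rw [map_zero] at this
      exact this.trans hgu
    -- Since `g` vanishes on `S`, subtracting a multiple of it keeps a subgradient; this multiple
    -- makes its value at `φ s - x₀` equal to `-1`.
    have := hext s hsD (ν' - ((ν' (φ s - x₀) + 1) / g (φ s - x₀)) • g) fun t ht => by
      simp only [sub_apply, smul_apply,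
        hg0 _ (t - s).2, hν', smul_zero, sub_zero]
      exact h1 t ht
    simp only [sub_apply, smul_apply, smul_eq_mul] at this
    rw [div_mul_cancel₀ _ hgpos.ne'] at this
    linarith
  have hφx₀ : φ ⟨x₀ - p, hx₀S⟩ = x₀ := add_sub_cancel p x₀
  obtain ⟨h1, h2⟩ := mem_of_related_of_interior_nonempty (x₀ := ⟨x₀ - p, hx₀S⟩) hDconv hDcl hDint
    hHdiag hHconv hHlsc hHusc (by
      intro s hs ν hν
      obtain ⟨ν', hν', -⟩ := exists_extension_norm_eq S ν
      have := hext s hs ν' fun t ht => by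
        rw [hν']
        exact hν t ht
      rwa [← hφx₀, hdiff, hν'] at this)
  rw [mem_preimage, hφx₀] at h1
  refine ⟨h1, fun z hz => ?_⟩
  obtain ⟨t, ht, rfl⟩ := hlift z hz
  simpa only [H, hφx₀] using h2 t ht

end MaxMonBifunction

theorem mainTheorem2 {X : Type*} [NormedAddCommGroup X] [NormedSpace ℝ X] [CompleteSpace X]
    (C : Set X) (hCconv : Convex ℝ C) (hCclosed : IsClosed C)
    (hCsqri : (MaxMonBifunction.sqri C).Nonempty)
    (F : X → X → ℝ) (hFdiag : ∀ x ∈ C, F x x = 0)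
    (hFmono : MaxMonBifunction.IsMonotoneBifun C F)
    (hFconv : ∀ x ∈ C, ConvexOn ℝ C (fun y => F x y))
    (hFlsc : ∀ x ∈ C, LowerSemicontinuousOn (fun y => F x y) C)
    (hFusc : ∀ y ∈ C, MaxMonBifunction.UpperHemicontOn (fun x => F x y) C) :
    MaxMonBifunction.IsMaximalMonotoneBifun C F := by
  refine ⟨hFmono, ?_, ?_⟩
  · rintro x y x' ⟨hx, hx'⟩ y' ⟨hy, hy'⟩
    have h1 := hx' y hy
    have h2 := hy' x hx
    have h3 := hFmono x hx y hy
    rw [hFdiag x hx] at h1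
    rw [hFdiag y hy] at h2
    simp only [sub_apply, map_sub] at h1 h2 ⊢
    linarith
  · rintro T hT ⟨hsub, hnot⟩
    refine hnot ?_
    rintro ⟨x₀, x'⟩ hx'
    obtain ⟨h1, h2⟩ := MaxMonBifunction.mem_of_related hCconv hCclosed hCsqri (x₀ := x₀)
      -- With this tilt, `ν` is a subgradient of `G y` at `y` exactly when `ν + x'` is one of `F y`.
      (G := fun x y => F x y + x' (x - y)) (fun x hx => by simp [hFdiag x hx])
      (fun x hx => (hFconv x hx).add ⟨hCconv, fun a _ b _ s t _ _ hst => le_of_eq <| by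
        simp only [map_sub, map_add, map_smul, smul_eq_mul]
        linear_combination (-(x' x)) * hst⟩)
      (fun x hx => (hFlsc x hx).add
        (Continuous.continuousOn (by fun_prop)).lowerSemicontinuousOn)
      (fun y hy a ha b hb => (hFusc y hy a ha b hb).add
        (Continuous.continuousOn (by fun_prop)).upperSemicontinuousOn)
      (fun y hy ν hν => by
        have hmem : (y, ν + x') ∈ MaxMonBifunction.graph (MaxMonBifunction.opA C F) := by
          refine ⟨hy, fun c hc => ?_⟩
          have := hν c hc
          rw [hFdiag y hy]
          simp only [add_apply, map_sub] at this ⊢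
          linarith
        simpa using hT x₀ y x' hx' (ν + x') (hsub hmem))
    refine ⟨h1, fun c hc => ?_⟩
    have := h2 c hc
    rw [hFdiag x₀ h1]
    simp only [map_sub] at this ⊢
    linarith
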